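/- All spaces are Tychonoff (completely regular and $T_1$). For a space $X$, a cover of $X$ is a family $\mathcal U$ of subsets of $X$ with $\bigcup\mathcal U=X$ and $X\notin\mathcal U$. A zero-set is a set $f^{-1}(0)$ with $f:X\to\mathbb R$ continuous; a cozero-set is the complement of a zero-set. A $\gamma$-cover is an infinite cover $\mathcal U$ such that each point of $X$ belongs to all but finitely many members of $\mathcal U$. Put - $\mathcal O$: all open covers of $X$; $\Gamma$: all $\gamma$-covers of $X$ by open sets; $\mathcal O^{\omega}_{cz}$: all countable covers of $X$ by cozero-sets; - $\Gamma_F$: all countable $\gamma$-covers $\mathcal U$ of $X$ by cozero-sets for which there is a $\gamma$-cover $\{F_U:U\in\mathcal U\}$ of $X$ by zero-sets with $F_U\subseteq U$ for all $U\in\mathcal U$; - $\Omega^{gr}$: all open covers $\mathcal U$ of $X$ that admit a partition $\{\mathcal P_k:k\in\mathbb N\}$ into infinitely many nonempty finite parts such that, for each finite $F\subseteq X$ and all but finitely many $k$, some $U\in\mathcal P_k$ satisfies $F\subseteq U$. $S_{fin}(\mathcal A,\mathcal B)$: for every sequence $(A_n)_{n\in\mathbb N}$ in $\mathcal A$ there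 are finite sets $B_n\subseteq A_n$ with $\bigcup_n B_n\in\mathcal B$. $U_{fin}(\mathcal A,\mathcal B)$: for every sequence $(\mathcal U_n)_{n\in\mathbb N}$ in $\mathcal A$ such that no $\mathcal U_n$ contains a finite subcover, there are finite $\mathcal F_n\subseteq\mathcal U_n$ with $\{\bigcup\mathcal F_n:n\in\mathbb N\}\in\mathcal B$. A space is Hurewicz if it satisfies $U_{fin}(\mathcal O,\Gamma)$, and projectively Hurewicz if each of its separable metrizable continuous images is Hurewicz. For a space $Y$ and $x\in Y$, $\Gamma_x$ is the family of all infinite $A\subseteq Y$ with $x\notin A$ such that $A\setminus W$ is finite for each neighbourhood $W$ of $x$; and $w\Gamma_x$ is the family of all $A\subseteq Y$ that admit a partition $\{S_n:n\in\mathbb N\}$ into infinitely many nonempty finite sets such that for each neighbourhood $W$ of $x$ there are points $s_n\in S_n$ $(n\in\mathbb N)$ with $s_n\in W$ for all but finitely many $n$. $C_p(X)$ is the space of continuous functions $X\to\mathbb R$ with the topology of pointwise convergence, and $\mathbf 0$ is the zero function. **Theorem.** For every Tychonoff space $X$ the following are equivalent: 1. $C_p(X)$ satisfies $S_{fin}(\Gamma_{\mathbf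 0},w\Gamma_{\mathbf 0})$; 2. $X$ satisfies $S_{fin}(\Gamma_F,\Omega^{gr})$; 3. $X$ satisfies $U_{fin}(\Gamma_F,\Gamma)$; 4. $X$ satisfies $U_{fin}(\mathcal O^{\omega}_{cz},\Gamma)$; 5. $X$ is projectively Hurewicz. -/

import Mathlib

open Set Filter Topology

universe u

namespace SelPrinciples

/-! ## Selection principles -/

/-- `S_fin(𝒜, ℬ)`: from each term of a sequence of members of `𝒜` one can select a finite subset
so that the union of the selected sets is a member of `ℬ`. -/
def SFin {α : Type*} (𝒜 ℬ : Set (Set α)) : Prop :=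
  ∀ A : ℕ → Set α, (∀ n, A n ∈ 𝒜) →
    ∃ B : ℕ → Set α, (∀ n, (B n).Finite ∧ B n ⊆ A n) ∧ (⋃ n, B n) ∈ ℬ

/-- `U_fin(𝒜, ℬ)`: for each sequence of members of `𝒜` none of which contains a finite subcover,
one can select finite subfamilies whose unions form a member of `ℬ`. -/
def UFin {X : Type*} (𝒜 ℬ : Set (Set (Set X))) : Prop :=
  ∀ 𝒰 : ℕ → Set (Set X), (∀ n, 𝒰 n ∈ 𝒜) →
    (∀ n, ¬ ∃ ℱ : Set (Set X), ℱ.Finite ∧ ℱ ⊆ 𝒰 n ∧ ⋃₀ ℱ = univ) →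
    ∃ ℱ : ℕ → Set (Set X), (∀ n, (ℱ n).Finite ∧ ℱ n ⊆ 𝒰 n) ∧ range (fun n => ⋃₀ ℱ n) ∈ ℬ

/-! ## Zero-sets and covers -/

/-- Zero-sets of a space. -/
def IsZeroSet {X : Type*} [TopologicalSpace X] (Z : Set X) : Prop :=
  ∃ f : X → ℝ, Continuous f ∧ Z = f ⁻¹' {0}

/-- Cozero-sets: complements of zero-sets. -/
def IsCozeroSet {X : Type*} [TopologicalSpace X] (U : Set X) : Prop :=
  IsZeroSet Uᶜ

/-- Covers are nontrivial: the whole space is not a member. -/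
def IsCover {X : Type*} (𝒰 : Set (Set X)) : Prop :=
  ⋃₀ 𝒰 = univ ∧ univ ∉ 𝒰

/-- An infinite cover such that each point lies in all but finitely many members. -/
def IsGammaCover {X : Type*} (𝒰 : Set (Set X)) : Prop :=
  IsCover 𝒰 ∧ 𝒰.Infinite ∧ ∀ x : X, {U ∈ 𝒰 | x ∉ U}.Finite

/-- A cozero `γ`-cover `𝒰` for which there is a `γ`-cover `{F_U : U ∈ 𝒰}` consisting of
zero-sets with `F_U ⊆ U`. -/
def IsGammaFShrinkable {X : Type*} [TopologicalSpace X] (𝒰 : Set (Set X)) : Prop :=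
  IsGammaCover 𝒰 ∧ (∀ U ∈ 𝒰, IsCozeroSet U) ∧
    ∃ F : Set X → Set X, (∀ U ∈ 𝒰, IsZeroSet (F U) ∧ F U ⊆ U) ∧ IsGammaCover (F '' 𝒰)

/-- A cover with a partition `{P k : k ∈ ℕ}` into nonempty finite parts such that, for each
finite `F`, all but finitely many parts have a member containing `F`. -/
def IsOmegaGroupable {X : Type*} (𝒰 : Set (Set X)) : Prop :=
  IsCover 𝒰 ∧ ∃ P : ℕ → Set (Set X),
    (∀ k, (P k).Finite ∧ (P k).Nonempty) ∧
    Pairwise (fun k l => Disjoint (P k) (P l)) ∧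
    (⋃ k, P k) = 𝒰 ∧
    ∀ F : Set X, F.Finite → {k : ℕ | ¬ ∃ U ∈ P k, F ⊆ U}.Finite

/-- `𝒪`: open covers. -/
def openCovers (X : Type*) [TopologicalSpace X] : Set (Set (Set X)) :=
  {𝒰 | IsCover 𝒰 ∧ ∀ U ∈ 𝒰, IsOpen U}

/-- `𝒪^ω_cz`: countable covers by cozero-sets. -/
def countableCozeroCovers (X : Type*) [TopologicalSpace X] : Set (Set (Set X)) :=
  {𝒰 | IsCover 𝒰 ∧ 𝒰.Countable ∧ ∀ U ∈ 𝒰, IsCozeroSet U}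

/-- `Γ`: open `γ`-covers. -/
def gammaCovers (X : Type*) [TopologicalSpace X] : Set (Set (Set X)) :=
  {𝒰 | IsGammaCover 𝒰 ∧ ∀ U ∈ 𝒰, IsOpen U}

/-- `Γ_F`: (countable) `γ_F`-shrinkable covers. -/
def gammaFCovers (X : Type*) [TopologicalSpace X] : Set (Set (Set X)) :=
  {𝒰 | IsGammaFShrinkable 𝒰 ∧ 𝒰.Countable}

/-- `Ω^gr`: open `ω`-groupable covers. -/
def omegaGroupableCovers (X : Type*) [TopologicalSpace X] : Set (Set (Set X)) :=
  {𝒰 | IsOmegaGroupable 𝒰 ∧ ∀ U ∈ 𝒰, IsOpen U}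

/-! ## The Hurewicz property -/

/-- A space is Hurewicz if it satisfies `U_fin(𝒪, Γ)`. -/
def IsHurewicz (X : Type*) [TopologicalSpace X] : Prop :=
  UFin (openCovers X) (gammaCovers X)

/-- Every separable metrizable continuous image is Hurewicz. (An image of `X` has, up to
homeomorphism, its points in the universe of `X`.) -/
def IsProjectivelyHurewicz (X : Type u) [TopologicalSpace X] : Prop :=
  ∀ (Y : Type u) [TopologicalSpace Y] [TopologicalSpace.MetrizableSpace Y]
    [TopologicalSpace.SeparableSpace Y] (f : X → Y),
    Continuous f → Function.Surjective f → IsHurewicz Y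

/-! ## Local collections and `C_p(X)` -/

/-- `Γ_x`: infinite sets `A` with `x ∉ A` such that each neighbourhood of `x` contains all but
finitely many points of `A`. -/
def gammaAt {Y : Type*} [TopologicalSpace Y] (x : Y) : Set (Set Y) :=
  {A | A.Infinite ∧ x ∉ A ∧ ∀ W ∈ 𝓝 x, (A \ W).Finite}

/-- Weak convergence of a sequence of sets to a point. -/
def WeaklyConverges {Y : Type*} [TopologicalSpace Y] (S : ℕ → Set Y) (x : Y) : Prop :=
  ∀ W ∈ 𝓝 x, ∃ s : ℕ → Y, (∀ n, s n ∈ S n) ∧ ∃ n' : ℕ, ∀ n > n', s n ∈ W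

/-- `wΓ_x`: sets with a partition `{S n : n ∈ ℕ}` into nonempty finite parts that weakly
converges to `x`. -/
def weakGammaAt {Y : Type*} [TopologicalSpace Y] (x : Y) : Set (Set Y) :=
  {A | ∃ S : ℕ → Set Y, (∀ n, (S n).Finite ∧ (S n).Nonempty) ∧
    Pairwise (fun m n => Disjoint (S m) (S n)) ∧ (⋃ n, S n) = A ∧ WeaklyConverges S x}

/-- `C_p(X)`: continuous real functions, with the topology of pointwise convergence (the subspace
topology from the product `X → ℝ`). -/
abbrev Cp (X : Type*) [TopologicalSpace X] : Type _ :=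
  {f : X → ℝ // Continuous f}

/-- The zero function in `C_p(X)`. -/
def Cp.zero (X : Type*) [TopologicalSpace X] : Cp X :=
  ⟨fun _ => 0, continuous_const⟩

end SelPrinciples

/-!
The hub of the equivalences is the property `U_fin(𝒪^ω_cz, Γ)`.

Its strongest consequence is that finite selections can be made from `γ`-covers which are good for
*finite sets* of points, although the property only speaks about single points, and no assumption is
made on the finite powers of `X` (`exists_finset_of_card`, `exists_finset_omega`). Let `U n m`, `m ∈ ℕ`, be
cozero-sets such that each point lies in almost all of them. By induction on `r` there are finite
sets `J n j ⊆ [j, ∞)` along which any `r` points have a common `U n m`, for almost all `n`. In the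
step, the sets `⋂ m ∈ J n (j + i), U n m`, `i ∈ ℕ`, cover `X`, so finitely many of them, `i ≤ a n j`,
catch each point for almost all `n` and all `j`. In the union of the `J n (j + i)` with `i ≤ a n j`
one of these `r + 1` points singles out a `J n (j + i)` along which it lies in every `U n m`, and the
other `r` points meet in some `U n m` with `m ∈ J n (j + i)`. The sets obtained for all `r ≤ n`
together serve all finite sets of points. Since `j` is free, the selections can also be made disjoint
for different `n` (`exists_pairwise_disjoint_image`), and this is what `Ω^gr` and, with
`U n m = {|f n m| < 1 / (n + 1)}`, the family `wΓ_𝟎` ask for.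

Conversely, given covers in `Γ_F`, one passes to common refinements of the first `n` of them
(`exists_refining_seq`); they remain in `Γ_F`, and the functions vanishing on the shrunk zero-sets
and equal to `1` off the cozero-sets converge to zero in `C_p(X)`. Either `S_fin` principle then
yields disjoint finite parts, and along a subsequence the `l`-th part refines the `l`-th cover
(`exists_strictMono_parts`, `exists_selection_of_parts`), which gives `U_fin(Γ_F, Γ)`. The latter
implies `U_fin(𝒪^ω_cz, Γ)` because the unions of initial segments of a countable cozero cover form
a cover in `Γ_F` when none of them is `X`.

Finally, countable cozero covers of `X` are the preimages of countable open covers of separable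
metrizable images: in one direction open covers are pulled back, in the other a sequence of
countable cozero covers is induced by a single map to `ℝ^(ℕ × ℕ)`.
-/

namespace SelPrinciples

/-! ### Indexed families and sequences of finite sets -/

/-- An indexed family of proper subsets to which each point belongs with finitely many exceptions
is automatically infinite as a set: a set repeated infinitely often would have to be `X`. -/
theorem isGammaCover_image {X ι : Type*} {A : ι → Set X} {I : Set ι} (hI : I.Infinite)
    (hne : ∀ i ∈ I, A i ≠ univ) (hfin : ∀ x, {i ∈ I | x ∉ A i}.Finite) :
    IsGammaCover (A '' I) := by
  refine ⟨⟨?_, ?_⟩, ?_, ?_⟩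
  · refine eq_univ_of_forall fun x => ?_
    obtain ⟨i, hi, hix⟩ := hI.exists_notMem_finite (hfin x)
    exact ⟨A i, mem_image_of_mem A hi, by_contra fun h => hix ⟨hi, h⟩⟩
  · rintro ⟨i, hi, h⟩
    exact hne i hi h
  · intro hA
    refine hI (Set.Finite.of_finite_fibers A hA ?_)
    rintro _ ⟨i, hi, rfl⟩
    obtain ⟨x, hx⟩ := (ne_univ_iff_exists_notMem _).1 (hne i hi)
    refine (hfin x).subset ?_
    rintro j ⟨hj, hji⟩
    exact ⟨hj, by rw [show A j = A i from hji]; exact hx⟩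
  · intro x
    refine ((hfin x).image A).subset ?_
    rintro _ ⟨⟨i, hi, rfl⟩, hx⟩
    exact ⟨i, ⟨hi, hx⟩, rfl⟩

theorem isGammaCover_range {X : Type*} {A : ℕ → Set X} (hne : ∀ i, A i ≠ univ)
    (hA : ∀ x, ∀ᶠ i in atTop, x ∈ A i) : IsGammaCover (range A) := by
  rw [← image_univ]
  refine isGammaCover_image infinite_univ (fun i _ => hne i) fun x => ?_
  have := hA x
  rw [← Nat.cofinite_eq_atTop, eventually_cofinite] at this
  simpa using this

theorem exists_strictMono_injective_comp {α : Type*} {f : ℕ → α} (hf : (range f).Infinite) :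
    ∃ e : ℕ → ℕ, StrictMono e ∧ Function.Injective (f ∘ e) := by
  classical
  obtain ⟨s, -, hs⟩ := (surjOn_image f univ).exists_bijOn_subset
  rw [image_univ] at hs
  have hsi : s.Infinite := fun h => hf (hs.image_eq ▸ h.image f)
  have : Infinite s := hsi.to_subtype
  refine ⟨fun n => Nat.orderEmbeddingOfSet s n, (Nat.orderEmbeddingOfSet s).strictMono, ?_⟩
  have hmem : ∀ n, Nat.orderEmbeddingOfSet s n ∈ s := fun n => by
    have := mem_range_self (f := Nat.orderEmbeddingOfSet s) n
    rwa [Nat.orderEmbeddingOfSet_range] at this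
  intro a b hab
  exact (Nat.orderEmbeddingOfSet s).injective
    (hs.injOn (hmem a) (hmem b) hab)

/-- If disjoint parts `P k` cover nothing beyond the finite sets `B n`, then along a strictly
increasing sequence `k l` the parts only use members of the sets `B n` with `n ≥ l`. -/
theorem exists_strictMono_parts {α : Type*} {B P : ℕ → Set α} (hB : ∀ n, (B n).Finite)
    (hP : Pairwise fun k l => Disjoint (P k) (P l)) (hPB : ⋃ k, P k ⊆ ⋃ n, B n) :
    ∃ k : ℕ → ℕ, StrictMono k ∧ ∀ l, ∀ u ∈ P (k l), ∃ n, l ≤ n ∧ u ∈ B n := by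
  refine extraction_forall_of_eventually (P := fun l k => ∀ u ∈ P k, ∃ n, l ≤ n ∧ u ∈ B n)
    fun l => ?_
  have hfin : (⋃ n ∈ Finset.range l, B n).Finite :=
    Set.Finite.biUnion (Finset.range l).finite_toSet fun n _ => hB n
  rw [← Nat.cofinite_eq_atTop, eventually_cofinite]
  -- Each of the finitely many elements chosen before `l` lies in at most one part.
  refine (hfin.biUnion (t := fun u => {k | u ∈ P k}) fun u _ => ?_).subset ?_
  · refine Set.Subsingleton.finite fun k hk l hl => ?_
    by_contra hne
    exact disjoint_left.1 (hP hne) hk hl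
  · intro k hk
    simp only [mem_ofPred_eq, not_forall, not_exists, not_and] at hk
    obtain ⟨u, huk, hu⟩ := hk
    obtain ⟨n, hn⟩ := mem_iUnion.1 (hPB (mem_iUnion.2 ⟨k, huk⟩))
    refine mem_biUnion (x := u) (mem_biUnion (x := n) ?_ hn) huk
    simpa using lt_of_not_ge fun h => hu n h hn

/-- Finite sets `T n j ⊆ [j, ∞)` of indices can be placed so far out, one after the other, that the
sets they index in the injective sequences `g n` are pairwise disjoint. -/
theorem exists_pairwise_disjoint_image {α : Type*} {g : ℕ → ℕ → α}
    (hg : ∀ n, Function.Injective (g n)) {T : ℕ → ℕ → Finset ℕ}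
    (hT : ∀ n j, ∀ m ∈ T n j, j ≤ m) :
    ∃ j : ℕ → ℕ, Pairwise fun k l => Disjoint (g k '' T k (j k)) (g l '' T l (j l)) := by
  classical
  have step : ∀ (n : ℕ) (E : Finset α), ∃ j, ∀ m ∈ T n j, g n m ∉ E := by
    intro n E
    have hfin : {m | g n m ∈ E}.Finite := E.finite_toSet.preimage (hg n).injOn
    obtain ⟨b, hb⟩ := hfin.bddAbove
    refine ⟨b + 1, fun m hm hE => ?_⟩
    have h1 := hT n _ m hm
    have h2 : m ≤ b := hb hE
    omega
  choose J hJ using step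
  -- `used n` collects everything indexed at the stages before `n`.
  let used : ℕ → Finset α := fun n =>
    Nat.rec ∅ (fun n E => E ∪ (T n (J n E)).image (g n)) n
  have hsucc : ∀ n, used (n + 1) = used n ∪ (T n (J n (used n))).image (g n) := fun n => rfl
  have hmono : Monotone used := monotone_nat_of_le_succ fun n => by
    rw [hsucc]; exact Finset.subset_union_left
  have key : ∀ k l, k < l →
      Disjoint (g k '' T k (J k (used k))) (g l '' T l (J l (used l))) := by
    intro k l hkl
    refine disjoint_left.2 ?_
    rintro _ ⟨m, hm, rfl⟩ ⟨m', hm', he⟩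
    refine hJ l (used l) m' hm' (he ▸ hmono (Nat.succ_le_of_lt hkl) ?_)
    rw [Nat.succ_eq_add_one, hsucc]
    exact Finset.mem_union_right _ (Finset.mem_image_of_mem _ hm)
  refine ⟨fun n => J n (used n), fun k l hkl => ?_⟩
  rcases lt_or_gt_of_ne hkl with h | h
  · exact key k l h
  · exact (key l k h).symm

section

variable {X : Type*} [TopologicalSpace X]

/-! ### Zero-sets and cozero-sets -/

theorem isCozeroSet_iff {U : Set X} :
    IsCozeroSet U ↔ ∃ f : X → ℝ, Continuous f ∧ U = {x | f x ≠ 0} := by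
  refine exists_congr fun f => and_congr_right fun _ => ?_
  rw [compl_eq_comm, eq_comm]
  rfl

theorem IsCozeroSet.isOpen {U : Set X} (hU : IsCozeroSet U) : IsOpen U := by
  obtain ⟨f, hf, rfl⟩ := isCozeroSet_iff.1 hU
  exact isOpen_ne_fun hf continuous_const

theorem isCozeroSet_biInter {ι : Type*} (s : Finset ι) {U : ι → Set X}
    (hU : ∀ i ∈ s, IsCozeroSet (U i)) : IsCozeroSet (⋂ i ∈ s, U i) := by
  choose! f hf hUf using fun i hi => isCozeroSet_iff.1 (hU i hi)
  refine isCozeroSet_iff.2 ⟨fun x => ∏ i ∈ s, f i x, continuous_finsetProd s hf, ?_⟩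
  ext x
  simp only [mem_iInter, mem_ofPred_eq, Finset.prod_ne_zero_iff]
  refine forall₂_congr fun i hi => ?_
  rw [hUf i hi]; rfl

theorem isCozeroSet_biUnion {ι : Type*} (s : Finset ι) {U : ι → Set X}
    (hU : ∀ i ∈ s, IsCozeroSet (U i)) : IsCozeroSet (⋃ i ∈ s, U i) := by
  choose! f hf hUf using fun i hi => isCozeroSet_iff.1 (hU i hi)
  refine isCozeroSet_iff.2 ⟨fun x => ∑ i ∈ s, |f i x|,
    continuous_finsetSum s fun i hi => (hf i hi).abs, ?_⟩
  ext x
  have hnn : ∀ i ∈ s, 0 ≤ |f i x| := fun i _ => abs_nonneg _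
  simp only [mem_iUnion, mem_ofPred_eq, ne_eq, Finset.sum_eq_zero_iff_of_nonneg hnn, not_forall,
    abs_eq_zero]
  refine exists₂_congr fun i hi => ?_
  rw [hUf i hi]; rfl

theorem isZeroSet_biInter {ι : Type*} (s : Finset ι) {Z : ι → Set X}
    (hZ : ∀ i ∈ s, IsZeroSet (Z i)) : IsZeroSet (⋂ i ∈ s, Z i) := by
  have h := isCozeroSet_biUnion s (U := fun i => (Z i)ᶜ) fun i hi => by
    simpa [IsCozeroSet] using hZ i hi
  simpa [IsCozeroSet, compl_iUnion] using h

theorem isZeroSet_le {f : X → ℝ} (hf : Continuous f) (c : ℝ) : IsZeroSet {x | c ≤ f x} := by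
  refine ⟨fun x => min (f x - c) 0, by fun_prop, ?_⟩
  ext x
  simp

theorem isCozeroSet_lt {f : X → ℝ} (hf : Continuous f) (c : ℝ) : IsCozeroSet {x | f x < c} := by
  have h := isZeroSet_le hf c
  have : {x | f x < c}ᶜ = {x | c ≤ f x} := by ext x; simp
  rwa [IsCozeroSet, this]

/-- Disjoint zero-sets are completely separated, by the quotient `|f| / (|f| + |g|)`. -/
theorem exists_continuous_separating {F U : Set X} (hF : IsZeroSet F) (hU : IsCozeroSet U)
    (hFU : F ⊆ U) :
    ∃ h : X → ℝ, Continuous h ∧ (∀ x ∈ F, h x = 0) ∧ ∀ x, x ∉ U → h x = 1 := by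
  obtain ⟨f, hf, rfl⟩ := hF
  obtain ⟨g, hg, rfl⟩ := isCozeroSet_iff.1 hU
  have hne : ∀ x, |f x| + |g x| ≠ 0 := by
    intro x hx
    have h1 : |f x| = 0 := by linarith [abs_nonneg (f x), abs_nonneg (g x)]
    have h2 : |g x| = 0 := by linarith [abs_nonneg (f x), abs_nonneg (g x)]
    exact hFU (show x ∈ f ⁻¹' {0} by simpa using h1) (by simpa using h2)
  refine ⟨fun x => |f x| / (|f x| + |g x|), hf.abs.div (hf.abs.add hg.abs) hne, ?_, ?_⟩
  · intro x hx
    have : f x = 0 := hx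
    simp [this]
  · intro x hx
    have hgx : g x = 0 := by simpa using hx
    have := hne x
    rw [hgx, abs_zero, add_zero] at this
    simp only [hgx, abs_zero, add_zero]
    exact div_self this

/-! ### Covers in `Γ_F` as sequences -/

/-- A family of zero-sets `F m ⊆ U m` witnesses that `{U m}` belongs to `Γ_F`, repetitions in the
enumeration notwithstanding. -/
theorem range_mem_gammaFCovers {U F : ℕ → Set X} (hU : ∀ m, IsCozeroSet (U m))
    (hF : ∀ m, IsZeroSet (F m)) (hFU : ∀ m, F m ⊆ U m) (hne : ∀ m, U m ≠ univ)
    (hev : ∀ x, ∀ᶠ m in atTop, x ∈ F m) : range U ∈ gammaFCovers X := by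
  have hγ : IsGammaCover (range U) :=
    isGammaCover_range hne fun x => (hev x).mono fun m hm => hFU m hm
  have hFne : ∀ m, F m ≠ univ := fun m h => hne m (univ_subset_iff.1 (h ▸ hFU m))
  choose! idx hidx using fun (V : Set X) (hV : V ∈ range U) => hV
  refine ⟨⟨hγ, ?_, F ∘ idx, ?_, ?_⟩, countable_range U⟩
  · rintro _ ⟨m, rfl⟩
    exact hU m
  · intro V hV
    refine ⟨hF _, ?_⟩
    have := hFU (idx V)
    rwa [hidx V hV] at this
  · rw [image_comp]
    have hinj : InjOn idx (range U) := fun V hV W hW h => by rw [← hidx V hV, ← hidx W hW, h]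
    refine isGammaCover_image (hγ.2.1.image hinj) (fun i _ => hFne i) fun x => ?_
    have := hev x
    rw [← Nat.cofinite_eq_atTop, eventually_cofinite] at this
    exact this.subset fun i hi => hi.2

/-- The zero-sets attached to the members of a cover in `Γ_F` may coincide for infinitely many
members, in which case they say nothing about those; they are distinct along a sequence. -/
theorem exists_seq_of_mem_gammaFCovers {𝒰 : Set (Set X)} (h : 𝒰 ∈ gammaFCovers X) :
    ∃ U F : ℕ → Set X, Function.Injective U ∧ (∀ m, U m ∈ 𝒰) ∧ (∀ m, IsZeroSet (F m)) ∧
      (∀ m, F m ⊆ U m) ∧ ∀ x, ∀ᶠ m in atTop, x ∈ F m := by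
  obtain ⟨⟨-, -, F, hF, ⟨-, hinf, hfin⟩⟩, -⟩ := h
  have e := hinf.natEmbedding
  have he : ∀ m, ∃ U ∈ 𝒰, F U = e m := fun m => (e m).2
  choose U hU hUe using he
  have hinj : Function.Injective fun m => F (U m) := fun a b hab => by
    simp only [hUe] at hab
    exact e.injective (Subtype.ext hab)
  refine ⟨U, fun m => F (U m), fun a b hab => hinj (congrArg F hab), hU,
    fun m => (hF _ (hU m)).1, fun m => (hF _ (hU m)).2, fun x => ?_⟩
  rw [← Nat.cofinite_eq_atTop, eventually_cofinite]
  refine Set.Finite.of_finite_image ((hfin x).subset ?_) hinj.injOn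
  rintro _ ⟨m, hm, rfl⟩
  exact ⟨⟨_, hU m, rfl⟩, hm⟩

/-! ### Selections from countable cozero covers and from `γ`-covers -/

/-- The form in which `U_fin(𝒪^ω_cz, Γ)` is used: the covers are sequences, without any restriction
on finite subcovers, and each point is caught at all but finitely many indices rather than in all
but finitely many members of a set of unions. -/
theorem UFin.exists_bound (h : UFin (countableCozeroCovers X) (gammaCovers X))
    {V : ℕ → ℕ → Set X} (hV : ∀ n i, IsCozeroSet (V n i)) (hcov : ∀ n x, ∃ i, x ∈ V n i) :
    ∃ a : ℕ → ℕ, ∀ x, ∀ᶠ n in atTop, ∃ i ≤ a n, x ∈ V n i := by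
  classical
  let G : ℕ → ℕ → Set X := fun n s => ⋃ i ∈ Finset.range (s + 1), V n i
  have hG : ∀ n s, IsCozeroSet (G n s) := fun n s => isCozeroSet_biUnion _ fun i _ => hV n i
  have hGmem : ∀ {n s x}, x ∈ G n s ↔ ∃ i ≤ s, x ∈ V n i := by
    intro n s x
    simp [G]
  have hGmono : ∀ n, Monotone (G n) := fun n s t hst x hx => by
    obtain ⟨i, hi, hx⟩ := hGmem.1 hx
    exact hGmem.2 ⟨i, hi.trans hst, hx⟩
  by_cases hbad : ∃ b, ∀ s, G b s ≠ univ
  swap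
  · push Not at hbad
    choose a ha using hbad
    exact ⟨a, fun x => Eventually.of_forall fun n => hGmem.1 (ha n ▸ mem_univ x)⟩
  obtain ⟨b, hb⟩ := hbad
  -- The indices without finite subcover; intersecting over those up to `n` makes the `n`-th cover
  -- refine the earlier ones, so that a selection from it serves every earlier index as well.
  let I : ℕ → Finset ℕ := fun n =>
    insert b ((Finset.range (n + 1)).filter fun l => ∀ s, G l s ≠ univ)
  let D : ℕ → ℕ → Set X := fun n s => ⋂ l ∈ I n, G l s
  have hD : ∀ n s, IsCozeroSet (D n s) := fun n s => isCozeroSet_biInter _ fun l _ => hG l s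
  have hDmono : ∀ n, Monotone (D n) := fun n s t hst =>
    iInter₂_mono fun l _ => hGmono l hst
  have hDb : ∀ n s, D n s ⊆ G b s := fun n s =>
    biInter_subset_of_mem (Finset.mem_insert_self _ _)
  have hDne : ∀ n s, D n s ≠ univ := fun n s hu => hb s (univ_subset_iff.1 (hu ▸ hDb n s))
  have hDcov : ∀ n x, ∃ s, x ∈ D n s := by
    intro n x
    choose i hi using fun l => hcov l x
    refine ⟨(I n).sup i, mem_iInter₂.2 fun l hl => ?_⟩
    exact hGmem.2 ⟨i l, Finset.le_sup hl, hi l⟩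
  have hfinsub : ∀ n (ℱ : Set (Set X)), ℱ.Finite → ℱ ⊆ range (D n) → ∃ s, ⋃₀ ℱ ⊆ D n s := by
    intro n ℱ hfin hsub
    choose! t ht using hsub
    obtain ⟨s, hs⟩ := (hfin.image t).bddAbove
    refine ⟨s, sUnion_subset fun W hW => ?_⟩
    rw [← ht hW]
    exact hDmono n (hs (mem_image_of_mem t hW))
  obtain ⟨ℱ, hℱ, hγ⟩ := h (fun n => range (D n))
    (fun n => by
      refine ⟨⟨?_, ?_⟩, countable_range _, ?_⟩
      · refine eq_univ_of_forall fun x => ?_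
        obtain ⟨s, hs⟩ := hDcov n x
        exact ⟨_, ⟨s, rfl⟩, hs⟩
      · rintro ⟨s, hs⟩
        exact hDne n s hs
      · rintro _ ⟨s, rfl⟩
        exact hD n s)
    (fun n => by
      rintro ⟨ℱ, hfin, hsub, hu⟩
      obtain ⟨s, hs⟩ := hfinsub n ℱ hfin hsub
      exact hDne n s (univ_subset_iff.1 (hu ▸ hs)))
  choose s hs using fun n => hfinsub n (ℱ n) (hℱ n).1 (hℱ n).2
  obtain ⟨e, he, hinj⟩ := exists_strictMono_injective_comp hγ.1.2.1
  have ha : ∀ l, ∃ a, (∀ x, x ∈ ⋃₀ ℱ (e l) → x ∈ G l a) := by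
    intro l
    by_cases hl : ∀ t, G l t ≠ univ
    · refine ⟨s (e l), fun x hx => mem_iInter₂.1 (hs _ hx) l ?_⟩
      refine Finset.mem_insert_of_mem (Finset.mem_filter.2 ⟨?_, hl⟩)
      exact Finset.mem_range.2 (Nat.lt_succ_of_le (he.id_le l))
    · push Not at hl
      obtain ⟨t, ht⟩ := hl
      exact ⟨t, fun x _ => ht ▸ mem_univ x⟩
  choose a ha using ha
  refine ⟨a, fun x => ?_⟩
  rw [← Nat.cofinite_eq_atTop, eventually_cofinite]
  refine Set.Finite.of_finite_image ((hγ.1.2.2 x).subset ?_) hinj.injOn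
  rintro _ ⟨l, hl, rfl⟩
  exact ⟨⟨e l, rfl⟩, fun hx => hl (hGmem.1 (ha l x hx))⟩

/-- For each `r`, finite sets `J n j ⊆ [j, ∞)` such that any `r` points have, for almost all `n` and
all `j`, a common `U n m` with `m ∈ J n j`. In the inductive step the sets
`⋂ m ∈ J n (j + i), U n m`, `i ∈ ℕ`, cover `X` for all `n` and `j`, because each point lies in almost
all `U n m`. A bound `a n j` for these covers gives the new index set
`⋃ i ≤ a n j, J n (j + i)`: it contains one old index set `J n (j + i)` along which a given point
lies in every `U n m`, and the other `r` points have a common `U n m` there. -/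
theorem exists_finset_of_card (h : UFin (countableCozeroCovers X) (gammaCovers X))
    {U : ℕ → ℕ → Set X} (hU : ∀ n m, IsCozeroSet (U n m))
    (hev : ∀ n x, ∀ᶠ m in atTop, x ∈ U n m) (r : ℕ) :
    ∃ J : ℕ → ℕ → Finset ℕ, (∀ n j, (J n j).Nonempty) ∧ (∀ n j, ∀ m ∈ J n j, j ≤ m) ∧
      ∀ F : Finset X, F.card ≤ r → ∀ᶠ n in atTop, ∀ j, ∃ m ∈ J n j, ↑F ⊆ U n m := by
  classical
  induction r with
  | zero =>
    refine ⟨fun _ j => {j}, fun _ j => Finset.singleton_nonempty j, by simp, fun F hF => ?_⟩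
    rw [Finset.card_eq_zero.1 (Nat.le_zero.1 hF)]
    simp
  | succ r ih =>
    obtain ⟨J, hJne, hJ, hJF⟩ := ih
    obtain ⟨a, ha⟩ := h.exists_bound
      (V := fun p i => ⋂ m ∈ J p.unpair.1 (p.unpair.2 + i), U p.unpair.1 m)
      (fun p i => isCozeroSet_biInter _ fun m _ => hU _ m)
      (fun p x => by
        obtain ⟨i, hi⟩ := eventually_atTop.1 (hev p.unpair.1 x)
        refine ⟨i, mem_iInter₂.2 fun m hm => hi m ?_⟩
        have := hJ _ _ m hm
        omega)
    refine ⟨fun n j => (Finset.range (a (Nat.pair n j) + 1)).biUnion fun i => J n (j + i),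
      fun n j => ?_, fun n j m hm => ?_, fun F hF => ?_⟩
    · obtain ⟨m, hm⟩ := hJne n (j + 0)
      exact ⟨m, Finset.mem_biUnion.2 ⟨0, by simp, hm⟩⟩
    · obtain ⟨i, -, hm⟩ := Finset.mem_biUnion.1 hm
      exact (Nat.le_add_right j i).trans (hJ _ _ m hm)
    · rcases F.eq_empty_or_nonempty with rfl | ⟨x, hx⟩
      · refine Eventually.of_forall fun n j => ?_
        obtain ⟨m, hm⟩ := hJne n (j + 0)
        exact ⟨m, Finset.mem_biUnion.2 ⟨0, by simp, hm⟩, by simp⟩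
      · have hcard : (F.erase x).card ≤ r := by
          rw [Finset.card_erase_of_mem hx]; omega
        obtain ⟨N, hN⟩ := eventually_atTop.1 (ha x)
        filter_upwards [hJF _ hcard, eventually_ge_atTop N] with n hn hNn j
        obtain ⟨i, hi, hxi⟩ := hN (Nat.pair n j) (hNn.trans (Nat.left_le_pair n j))
        simp only [Nat.unpair_pair] at hxi
        obtain ⟨m, hm, hFm⟩ := hn (j + i)
        refine ⟨m, Finset.mem_biUnion.2 ⟨i, by simpa [Nat.lt_succ_iff] using hi, hm⟩, ?_⟩
        intro y hy
        by_cases hyx : y = x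
        · rw [hyx]; exact mem_iInter₂.1 hxi m hm
        · exact hFm (by simpa [hyx] using hy)

/-- From sequences of cozero-sets in which each point lies eventually, finite sets of indices can be
selected that are good for the finite subsets of `X` of all sizes, beyond any prescribed index. -/
theorem exists_finset_omega (h : UFin (countableCozeroCovers X) (gammaCovers X))
    {U : ℕ → ℕ → Set X} (hU : ∀ n m, IsCozeroSet (U n m))
    (hev : ∀ n x, ∀ᶠ m in atTop, x ∈ U n m) :
    ∃ T : ℕ → ℕ → Finset ℕ, (∀ n j, (T n j).Nonempty) ∧ (∀ n j, ∀ m ∈ T n j, j ≤ m) ∧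
      ∀ F : Set X, F.Finite → ∀ᶠ n in atTop, ∀ j, ∃ m ∈ T n j, F ⊆ U n m := by
  classical
  choose J hJne hJ hJF using exists_finset_of_card h hU hev
  refine ⟨fun n j => (Finset.range (n + 1)).biUnion fun r => J r n j, fun n j => ?_,
    fun n j m hm => ?_, fun F hF => ?_⟩
  · obtain ⟨m, hm⟩ := hJne 0 n j
    exact ⟨m, Finset.mem_biUnion.2 ⟨0, by simp, hm⟩⟩
  · obtain ⟨r, -, hm⟩ := Finset.mem_biUnion.1 hm
    exact hJ r n j m hm
  · lift F to Finset X using hF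
    filter_upwards [hJF F.card F le_rfl, eventually_ge_atTop F.card] with n hn hcn j
    obtain ⟨m, hm, hFm⟩ := hn j
    exact ⟨m, Finset.mem_biUnion.2 ⟨F.card, by simpa [Nat.lt_succ_iff] using hcn, hm⟩, hFm⟩

/-! ### From `U_fin(𝒪^ω_cz, Γ)` to the two `S_fin` principles -/

theorem UFin.sFin_omegaGroupable (h : UFin (countableCozeroCovers X) (gammaCovers X)) :
    SFin (gammaFCovers X) (omegaGroupableCovers X) := by
  intro 𝒰 h𝒰
  choose U F hinj hmem hF hFU hev using fun n => exists_seq_of_mem_gammaFCovers (h𝒰 n)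
  have hU : ∀ n m, IsCozeroSet (U n m) := fun n m => (h𝒰 n).1.2.1 _ (hmem n m)
  obtain ⟨T, hTne, hT, hTF⟩ := exists_finset_omega h hU
    fun n x => (hev n x).mono fun m hm => hFU n m hm
  obtain ⟨j, hj⟩ := exists_pairwise_disjoint_image hinj hT
  have hsub : ∀ n, U n '' T n (j n) ⊆ 𝒰 n := fun n => by
    rintro _ ⟨m, -, rfl⟩
    exact hmem n m
  have hgood : ∀ E : Set X, E.Finite → ∀ᶠ n in atTop, ∃ W ∈ U n '' T n (j n), E ⊆ W := by
    intro E hE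
    filter_upwards [hTF E hE] with n hn
    obtain ⟨m, hm, hEm⟩ := hn (j n)
    exact ⟨U n m, ⟨m, hm, rfl⟩, hEm⟩
  refine ⟨fun n => U n '' T n (j n), fun n => ⟨(T n (j n)).finite_toSet.image _, hsub n⟩,
    ⟨⟨?_, ?_⟩, fun n => U n '' T n (j n), fun n => ⟨(T n (j n)).finite_toSet.image _, ?_⟩,
      hj, rfl, fun E hE => ?_⟩, ?_⟩
  · refine eq_univ_of_forall fun x => ?_
    obtain ⟨n, W, hW, hxW⟩ := (hgood {x} (finite_singleton x)).exists
    exact ⟨W, mem_iUnion.2 ⟨n, hW⟩, singleton_subset_iff.1 hxW⟩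
  · intro hu
    obtain ⟨n, hn⟩ := mem_iUnion.1 hu
    exact (h𝒰 n).1.1.1.2 (hsub n hn)
  · exact (Finset.coe_nonempty.2 (hTne n (j n))).image _
  · have := hgood E hE
    rwa [← Nat.cofinite_eq_atTop, eventually_cofinite] at this
  · intro W hW
    obtain ⟨n, hn⟩ := mem_iUnion.1 hW
    exact ((h𝒰 n).1.2.1 _ (hsub n hn)).isOpen

/-- The basic neighbourhoods of the zero function. -/
theorem Cp.exists_finite_of_mem_nhds_zero {W : Set (Cp X)} (hW : W ∈ 𝓝 (Cp.zero X)) :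
    ∃ E : Set X, E.Finite ∧ ∃ ε > 0, ∀ f : Cp X, (∀ x ∈ E, |f.1 x| < ε) → f ∈ W := by
  rw [nhds_subtype_eq_comap, mem_comap] at hW
  obtain ⟨V, hV, hVW⟩ := hW
  rw [nhds_pi, Filter.mem_pi] at hV
  obtain ⟨E, hE, t, ht, htV⟩ := hV
  choose ε hε hεt using fun x => Metric.mem_nhds_iff.1 (ht x)
  have hmin : ∃ δ > 0, ∀ x ∈ E, δ ≤ ε x := by
    rcases E.eq_empty_or_nonempty with rfl | hne
    · exact ⟨1, one_pos, by simp⟩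
    · obtain ⟨y, -, hy⟩ := hE.exists_minimalFor ε E hne
      refine ⟨ε y, hε y, fun x hx => ?_⟩
      by_contra hlt
      exact hlt (hy hx (le_of_not_ge hlt))
  obtain ⟨δ, hδ, hδε⟩ := hmin
  refine ⟨E, hE, δ, hδ, fun f hf => hVW (htV fun x hx => hεt x ?_)⟩
  simpa [Cp.zero, Real.dist_eq] using (hf x hx).trans_le (hδε x hx)

theorem Cp.setOf_abs_lt_mem_nhds_zero (x : X) {ε : ℝ} (hε : 0 < ε) :
    {f : Cp X | |f.1 x| < ε} ∈ 𝓝 (Cp.zero X) := by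
  have hcont : Continuous fun f : Cp X => |f.1 x| :=
    ((continuous_apply x).comp continuous_subtype_val).abs
  exact (isOpen_lt hcont continuous_const).mem_nhds (by simpa [Cp.zero] using hε)

theorem UFin.sFin_weakGammaAt (h : UFin (countableCozeroCovers X) (gammaCovers X)) :
    SFin (gammaAt (Cp.zero X)) (weakGammaAt (Cp.zero X)) := by
  intro A hA
  let f : ∀ n, ℕ → Cp X := fun n m => ((hA n).1.natEmbedding _ m).1
  have hinj : ∀ n, Function.Injective (f n) := fun n =>
    Subtype.val_injective.comp ((hA n).1.natEmbedding _).injective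
  have hmem : ∀ n m, f n m ∈ A n := fun n m => ((hA n).1.natEmbedding _ m).2
  have hpos : ∀ n : ℕ, (0 : ℝ) < 1 / (n + 1) := fun n => Nat.one_div_pos_of_nat
  obtain ⟨T, hTne, hT, hTF⟩ := exists_finset_omega h
    (U := fun n m => {x | |(f n m).1 x| < 1 / (n + 1)})
    (fun n m => isCozeroSet_lt (f n m).2.abs _) (fun n x => by
      rw [← Nat.cofinite_eq_atTop, eventually_cofinite]
      refine ((hA n).2.2 _ (Cp.setOf_abs_lt_mem_nhds_zero x (hpos n))).preimage
        (hinj n).injOn |>.subset fun m hm => ⟨hmem n m, hm⟩)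
  obtain ⟨j, hj⟩ := exists_pairwise_disjoint_image hinj hT
  have hfin : ∀ n, (f n '' T n (j n)).Finite := fun n => (T n (j n)).finite_toSet.image _
  have hne : ∀ n, (f n '' T n (j n)).Nonempty := fun n =>
    (Finset.coe_nonempty.2 (hTne n (j n))).image _
  refine ⟨fun n => f n '' T n (j n), fun n => ⟨hfin n, ?_⟩, fun n => f n '' T n (j n),
    fun n => ⟨hfin n, hne n⟩, hj, rfl, fun W hW => ?_⟩
  · rintro _ ⟨m, -, rfl⟩
    exact hmem n m
  · obtain ⟨E, hE, ε, hε, hEW⟩ := Cp.exists_finite_of_mem_nhds_zero hW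
    have hev : ∀ᶠ n in atTop, ∃ g ∈ f n '' T n (j n), g ∈ W := by
      obtain ⟨N, hN⟩ := exists_nat_one_div_lt hε
      filter_upwards [hTF E hE, eventually_ge_atTop N] with n hn hNn
      obtain ⟨m, hm, hEm⟩ := hn (j n)
      refine ⟨f n m, ⟨m, hm, rfl⟩, hEW _ fun x hx => (hEm hx).trans ?_⟩
      exact (Nat.one_div_le_one_div hNn).trans_lt hN
    have hs : ∀ n, ∃ g ∈ f n '' T n (j n),
        (∃ g ∈ f n '' T n (j n), g ∈ W) → g ∈ W := by
      intro n
      by_cases hn : ∃ g ∈ f n '' T n (j n), g ∈ W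
      · obtain ⟨g, hg, hgW⟩ := hn
        exact ⟨g, hg, fun _ => hgW⟩
      · obtain ⟨g, hg⟩ := hne n
        exact ⟨g, hg, fun h => absurd h hn⟩
    choose s hsS hsW using hs
    obtain ⟨N, hN⟩ := eventually_atTop.1 hev
    exact ⟨s, hsS, N, fun n hn => hsW n (hN n hn.le)⟩

/-! ### From the two `S_fin` principles to `U_fin(Γ_F, Γ)` -/

/-- Covers in `Γ_F` may be replaced by members of `Γ_F`, given as sequences together with their
shrinkings, the `n`-th of which refines the `l`-th original cover for all `l ≤ n`. -/
theorem exists_refining_seq {𝒰 : ℕ → Set (Set X)} (h𝒰 : ∀ n, 𝒰 n ∈ gammaFCovers X) :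
    ∃ U F : ℕ → ℕ → Set X, (∀ n m, IsCozeroSet (U n m)) ∧ (∀ n m, IsZeroSet (F n m)) ∧
      (∀ n m, F n m ⊆ U n m) ∧ (∀ n m, U n m ≠ univ) ∧ (∀ n x, ∀ᶠ m in atTop, x ∈ F n m) ∧
      ∀ l n m, l ≤ n → ∃ V ∈ 𝒰 l, U n m ⊆ V := by
  choose U F _hinj hmem hF hFU hev using fun n => exists_seq_of_mem_gammaFCovers (h𝒰 n)
  have hsub : ∀ l n m, l ≤ n → ⋂ l ∈ Finset.range (n + 1), U l m ⊆ U l m := fun l n m hl =>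
    biInter_subset_of_mem (t := fun l => U l m) (Finset.mem_range.2 (Nat.lt_succ_of_le hl))
  refine ⟨fun n m => ⋂ l ∈ Finset.range (n + 1), U l m,
    fun n m => ⋂ l ∈ Finset.range (n + 1), F l m,
    fun n m => isCozeroSet_biInter _ fun l _ => (h𝒰 l).1.2.1 _ (hmem l m),
    fun n m => isZeroSet_biInter _ fun l _ => hF l m,
    fun n m => iInter₂_mono fun l _ => hFU l m, fun n m hu => ?_, fun n x => ?_,
    fun l n m hl => ⟨U l m, hmem l m, hsub l n m hl⟩⟩
  · have hU : U n m = univ := univ_subset_iff.1 (hu ▸ hsub n n m le_rfl)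
    exact (h𝒰 n).1.1.1.2 (hU ▸ hmem n m)
  · simp only [mem_iInter]
    exact (eventually_all_finset _).2 fun l _ => hev l x

theorem ne_univ_of_not_subcover {X : Type*} {𝒰 ℱ : Set (Set X)}
    (h : ¬ ∃ ℱ : Set (Set X), ℱ.Finite ∧ ℱ ⊆ 𝒰 ∧ ⋃₀ ℱ = univ) (hfin : ℱ.Finite) (hsub : ℱ ⊆ 𝒰) :
    ⋃₀ ℱ ≠ univ :=
  fun hu => h ⟨ℱ, hfin, hsub, hu⟩

/-- A selection for `U_fin` from disjoint finite parts `P k`, as provided both by `Ω^gr` and by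
`wΓ_𝟎`: each element `u` stands for a set `c u`, and if `u` was chosen at the stage `n`, then `c u` lies
in a member of the `l`-th cover for every `l ≤ n`. -/
theorem exists_selection_of_parts {α : Type*} {𝒰 : ℕ → Set (Set X)}
    (hopen : ∀ n, ∀ V ∈ 𝒰 n, IsOpen V)
    (hsc : ∀ n, ¬ ∃ ℱ : Set (Set X), ℱ.Finite ∧ ℱ ⊆ 𝒰 n ∧ ⋃₀ ℱ = univ)
    {B P : ℕ → Set α} {c : α → Set X} (hB : ∀ n, (B n).Finite) (hPfin : ∀ k, (P k).Finite)
    (hP : Pairwise fun k l => Disjoint (P k) (P l)) (hPB : ⋃ k, P k = ⋃ n, B n)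
    (hc : ∀ l n, l ≤ n → ∀ u ∈ B n, ∃ V ∈ 𝒰 l, c u ⊆ V)
    (hx : ∀ x, ∀ᶠ k in atTop, ∃ u ∈ P k, x ∈ c u) :
    ∃ ℱ : ℕ → Set (Set X), (∀ n, (ℱ n).Finite ∧ ℱ n ⊆ 𝒰 n) ∧
      range (fun n => ⋃₀ ℱ n) ∈ gammaCovers X := by
  obtain ⟨k, hk, hkB⟩ := exists_strictMono_parts hB hP hPB.subset
  have hV : ∀ l, ∃ ℱ : Set (Set X), ℱ.Finite ∧ ℱ ⊆ 𝒰 l ∧ ∀ u ∈ P (k l), c u ⊆ ⋃₀ ℱ := by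
    intro l
    have : ∀ u ∈ P (k l), ∃ V ∈ 𝒰 l, c u ⊆ V := fun u hu => by
      obtain ⟨n, hln, hun⟩ := hkB l u hu
      exact hc l n hln u hun
    choose! V hV hcV using this
    refine ⟨V '' P (k l), (hPfin _).image V, image_subset_iff.2 hV, fun u hu => ?_⟩
    exact (hcV u hu).trans (subset_sUnion_of_mem (mem_image_of_mem V hu))
  choose ℱ hfin hsub hcov using hV
  refine ⟨ℱ, fun l => ⟨hfin l, hsub l⟩, ?_, ?_⟩
  · refine isGammaCover_range (fun l => ne_univ_of_not_subcover (hsc l) (hfin l) (hsub l))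
      fun x => ?_
    filter_upwards [hk.tendsto_atTop.eventually (hx x)] with l hl
    obtain ⟨u, hu, hxu⟩ := hl
    exact hcov l u hu hxu
  · rintro _ ⟨l, rfl⟩
    exact isOpen_sUnion fun V hV => hopen l V (hsub l hV)

theorem SFin.uFin_of_omegaGroupable (h : SFin (gammaFCovers X) (omegaGroupableCovers X)) :
    UFin (gammaFCovers X) (gammaCovers X) := by
  intro 𝒰 h𝒰 hsc
  obtain ⟨U, F, hU, hF, hFU, hne, hev, href⟩ := exists_refining_seq h𝒰
  obtain ⟨B, hB, ⟨-, P, hPfin, hP, hPB, hPE⟩, -⟩ := h (fun n => range (U n)) fun n =>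
    range_mem_gammaFCovers (hU n) (hF n) (hFU n) (hne n) (hev n)
  refine exists_selection_of_parts (c := id) (fun n V hV => ((h𝒰 n).1.2.1 V hV).isOpen) hsc
    (fun n => (hB n).1) (fun k => (hPfin k).1) hP hPB ?_ fun x => ?_
  · intro l n hln W hW
    obtain ⟨m, rfl⟩ := (hB n).2 hW
    exact href l n m hln
  · have := hPE {x} (finite_singleton x)
    rw [← eventually_cofinite, Nat.cofinite_eq_atTop] at this
    simpa using this

theorem SFin.uFin_of_weakGammaAt (h : SFin (gammaAt (Cp.zero X)) (weakGammaAt (Cp.zero X))) :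
    UFin (gammaFCovers X) (gammaCovers X) := by
  intro 𝒰 h𝒰 hsc
  obtain ⟨U, F, hU, hF, hFU, hne, hev, href⟩ := exists_refining_seq h𝒰
  choose f hf hf0 hf1 using fun n m => exists_continuous_separating (hF n m) (hU n m) (hFU n m)
  let g : ℕ → ℕ → Cp X := fun n m => ⟨f n m, hf n m⟩
  have hg : ∀ n, ∀ W ∈ 𝓝 (Cp.zero X), ∀ᶠ m in atTop, g n m ∈ W := by
    intro n W hW
    obtain ⟨E, hE, ε, hε, hEW⟩ := Cp.exists_finite_of_mem_nhds_zero hW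
    filter_upwards [(eventually_all_finite hE).2 fun x _ => hev n x] with m hm
    refine hEW _ fun x hx => ?_
    simpa [g, hf0 n m x (hm x hx)] using hε
  have hfar : ∀ n m, ∃ x, f n m x = 1 := fun n m => by
    obtain ⟨x, hx⟩ := (ne_univ_iff_exists_notMem _).1 (hne n m)
    exact ⟨x, hf1 n m x hx⟩
  have hinf : ∀ n, (range (g n)).Infinite := by
    intro n hfin
    rw [← image_univ] at hfin
    refine infinite_univ (Set.Finite.of_finite_fibers (g n) hfin ?_)
    rintro _ ⟨m, -, rfl⟩
    obtain ⟨x, hx⟩ := hfar n m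
    have := hg n _ (Cp.setOf_abs_lt_mem_nhds_zero x one_pos)
    rw [← Nat.cofinite_eq_atTop, eventually_cofinite] at this
    refine this.subset ?_
    rintro i ⟨-, hi⟩
    have hi : f n i = f n m := congrArg Subtype.val hi
    simp [g, hi, hx]
  obtain ⟨B, hB, P, hPfin, hP, hPB, hPW⟩ := h (fun n => range (g n)) fun n => by
    refine ⟨hinf n, ?_, fun W hW => ?_⟩
    · rintro ⟨m, hm⟩
      obtain ⟨x, hx⟩ := hfar n m
      have : f n m x = 0 := congrFun (congrArg Subtype.val hm) x
      rw [hx] at this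
      exact one_ne_zero this
    · have := hg n W hW
      rw [← Nat.cofinite_eq_atTop, eventually_cofinite] at this
      refine (this.image (g n)).subset ?_
      rintro _ ⟨⟨m, rfl⟩, hm⟩
      exact ⟨m, hm, rfl⟩
  refine exists_selection_of_parts (c := fun u : Cp X => {x | |u.1 x| < 1})
    (fun n V hV => ((h𝒰 n).1.2.1 V hV).isOpen) hsc (fun n => (hB n).1) (fun k => (hPfin k).1)
    hP hPB ?_ fun x => ?_
  · intro l n hln u hu
    obtain ⟨m, rfl⟩ := (hB n).2 hu
    obtain ⟨V, hV, hUV⟩ := href l n m hln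
    refine ⟨V, hV, Subset.trans (fun x hx => ?_) hUV⟩
    by_contra hxU
    have hx : |f n m x| < 1 := hx
    rw [hf1 n m x hxU, abs_one] at hx
    exact lt_irrefl _ hx
  · obtain ⟨s, hs, N, hN⟩ := hPW _ (Cp.setOf_abs_lt_mem_nhds_zero x one_pos)
    filter_upwards [eventually_gt_atTop N] with k hk
    exact ⟨s k, hs k, hN k hk⟩

/-! ### From `U_fin(Γ_F, Γ)` to `U_fin(𝒪^ω_cz, Γ)` -/

theorem exists_seq_of_mem_countableCozeroCovers {𝒰 : Set (Set X)}
    (h : 𝒰 ∈ countableCozeroCovers X)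
    (hsc : ¬ ∃ ℱ : Set (Set X), ℱ.Finite ∧ ℱ ⊆ 𝒰 ∧ ⋃₀ ℱ = univ) :
    ∃ f : ℕ → X → ℝ, (∀ i, Continuous (f i)) ∧ 𝒰 = range fun i => {x | f i x ≠ 0} := by
  have hne : 𝒰.Nonempty := by
    by_contra hemp
    rw [not_nonempty_iff_eq_empty] at hemp
    exact hsc ⟨∅, finite_empty, empty_subset _, hemp ▸ h.1.1⟩
  obtain ⟨u, hu⟩ := h.2.1.exists_eq_range hne
  have hcz : ∀ i, IsCozeroSet (u i) := fun i => h.2.2 _ (hu ▸ mem_range_self i)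
  choose f hf hfu using fun i => isCozeroSet_iff.1 (hcz i)
  exact ⟨f, hf, by rw [hu]; exact congrArg range (funext hfu)⟩

/-- The unions of initial segments of a countable cozero cover `{f i ≠ 0}` are the cozero-sets of
the partial sums `h m` of `∑ |f i|`, and are shrunk by the zero-sets `{h m ≥ 1 / (m + 1)}`. -/
theorem UFin.uFin_countableCozeroCovers (h : UFin (gammaFCovers X) (gammaCovers X)) :
    UFin (countableCozeroCovers X) (gammaCovers X) := by
  intro 𝒰 h𝒰 hsc
  choose f hf hfu using fun n => exists_seq_of_mem_countableCozeroCovers (h𝒰 n) (hsc n)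
  let S : ℕ → ℕ → X → ℝ := fun n m x => ∑ i ∈ Finset.range (m + 1), |f n i x|
  have hS : ∀ n m, Continuous (S n m) := fun n m =>
    continuous_finsetSum _ fun i _ => (hf n i).abs
  have hSle : ∀ n i m x, i ≤ m → |f n i x| ≤ S n m x := fun n i m x him =>
    Finset.single_le_sum (f := fun i => |f n i x|) (fun i _ => abs_nonneg _)
      (Finset.mem_range.2 (Nat.lt_succ_of_le him))
  let U : ℕ → ℕ → Set X := fun n m => {x | S n m x ≠ 0}
  have hmemU : ∀ n m x, x ∈ U n m ↔ ∃ i ≤ m, f n i x ≠ 0 := by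
    intro n m x
    have hnn : ∀ i ∈ Finset.range (m + 1), 0 ≤ |f n i x| := fun i _ => abs_nonneg _
    simp [U, S, Finset.sum_eq_zero_iff_of_nonneg hnn]
  let 𝒲 : ℕ → ℕ → Set (Set X) := fun n m => (fun i => {x | f n i x ≠ 0}) '' Iic m
  have h𝒲 : ∀ n m, (𝒲 n m).Finite ∧ 𝒲 n m ⊆ 𝒰 n ∧ ⋃₀ 𝒲 n m = U n m := by
    intro n m
    refine ⟨(finite_Iic m).image _, ?_, ?_⟩
    · rw [hfu n]
      exact image_subset_range _ _
    · ext x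
      simp [𝒲, hmemU]
  have hUmono : ∀ n, Monotone (U n) := fun n m m' hm x hx => by
    obtain ⟨i, hi, hxi⟩ := (hmemU n m x).1 hx
    exact (hmemU n m' x).2 ⟨i, hi.trans hm, hxi⟩
  have hne : ∀ n m, U n m ≠ univ := fun n m => by
    obtain ⟨h1, h2, h3⟩ := h𝒲 n m
    exact h3 ▸ ne_univ_of_not_subcover (hsc n) h1 h2
  have hselect : ∀ n (ℱ : Set (Set X)), ℱ.Finite → ℱ ⊆ range (U n) →
      ℱ = ∅ ∨ ∃ m, ⋃₀ ℱ = U n m := by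
    intro n ℱ hfin hsub
    rcases ℱ.eq_empty_or_nonempty with rfl | hℱ
    · exact Or.inl rfl
    · right
      choose! t ht using fun V (hV : V ∈ ℱ) => hsub hV
      obtain ⟨W, hW, hmax⟩ := hfin.exists_maximalFor t ℱ hℱ
      refine ⟨t W, subset_antisymm (sUnion_subset fun V hV => ?_) ?_⟩
      · rw [← ht V hV]
        refine hUmono n ?_
        by_contra hlt
        exact hlt (hmax hV (le_of_not_ge hlt))
      · rw [ht W hW]
        exact subset_sUnion_of_mem hW
  obtain ⟨ℱ, hℱ, hγ⟩ := h (fun n => range (U n))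
    (fun n => by
      refine range_mem_gammaFCovers (F := fun m => {x | 1 / ((m : ℝ) + 1) ≤ S n m x})
        (fun m => isCozeroSet_iff.2 ⟨_, hS n m, rfl⟩) (fun m => isZeroSet_le (hS n m) _)
        (fun m x hx => ?_) (hne n) fun x => ?_
      · exact ((Nat.one_div_pos_of_nat (α := ℝ)).trans_le hx).ne'
      · have hx : x ∈ ⋃₀ 𝒰 n := (h𝒰 n).1.1 ▸ mem_univ x
        rw [hfu n] at hx
        obtain ⟨_, ⟨i, rfl⟩, hi⟩ := hx
        obtain ⟨N, hN⟩ := exists_nat_one_div_lt (abs_pos.2 hi)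
        filter_upwards [eventually_ge_atTop N, eventually_ge_atTop i] with m hNm him
        exact ((Nat.one_div_le_one_div hNm).trans hN.le).trans (hSle n i m x him))
    (fun n => by
      rintro ⟨ℱ, hfin, hsub, hu⟩
      rcases hselect n ℱ hfin hsub with rfl | ⟨m, hm⟩
      · exact hsc n ⟨∅, finite_empty, empty_subset _, hu⟩
      · exact hne n m (hm ▸ hu))
  have hfinal : ∀ n, ∃ 𝒢 : Set (Set X), 𝒢.Finite ∧ 𝒢 ⊆ 𝒰 n ∧ ⋃₀ 𝒢 = ⋃₀ ℱ n := by
    intro n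
    rcases hselect n (ℱ n) (hℱ n).1 (hℱ n).2 with h0 | ⟨m, hm⟩
    · exact ⟨∅, finite_empty, empty_subset _, by rw [h0]⟩
    · exact ⟨𝒲 n m, (h𝒲 n m).1, (h𝒲 n m).2.1, (h𝒲 n m).2.2.trans hm.symm⟩
  choose 𝒢 h1 h2 h3 using hfinal
  refine ⟨𝒢, fun n => ⟨h1 n, h2 n⟩, ?_⟩
  rwa [show (fun n => ⋃₀ 𝒢 n) = fun n => ⋃₀ ℱ n from funext h3]

end

/-! ### Separable metrizable images -/

theorem isGammaCover_preimage_image_iff {X Y : Type*} {f : X → Y} (hf : Function.Surjective f)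
    {𝒱 : Set (Set Y)} : IsGammaCover (preimage f '' 𝒱) ↔ IsGammaCover 𝒱 := by
  have hinj := hf.preimage_injective
  refine and_congr (and_congr ?_ ?_) (and_congr (infinite_image_iff hinj.injOn) ?_)
  · rw [← hinj.eq_iff (a := ⋃₀ 𝒱), preimage_sUnion, sUnion_image, preimage_univ]
  · rw [← preimage_univ (f := f), hinj.mem_set_image]
  · rw [hf.forall]
    refine forall_congr' fun x => ?_
    have : {U ∈ preimage f '' 𝒱 | x ∉ U} = preimage f '' {V ∈ 𝒱 | f x ∉ V} := by
      ext U
      constructor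
      · rintro ⟨⟨V, hV, rfl⟩, hx⟩
        exact ⟨V, ⟨hV, hx⟩, rfl⟩
      · rintro ⟨V, ⟨hV, hx⟩, rfl⟩
        exact ⟨⟨V, hV, rfl⟩, hx⟩
    rw [this, finite_image_iff hinj.injOn]

theorem sUnion_preimage_image {X Y : Type*} (f : X → Y) (𝒱 : Set (Set Y)) :
    ⋃₀ (preimage f '' 𝒱) = f ⁻¹' ⋃₀ 𝒱 := by
  rw [sUnion_image, preimage_sUnion]

theorem isCozeroSet_of_isOpen {Y : Type*} [TopologicalSpace Y] [TopologicalSpace.MetrizableSpace Y]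
    {V : Set Y} (hV : IsOpen V) (hne : V ≠ univ) : IsCozeroSet V := by
  let _ := TopologicalSpace.metrizableSpaceMetric Y
  refine ⟨fun y => Metric.infDist y Vᶜ, Metric.continuous_infDist_pt _, ?_⟩
  ext y
  exact hV.isClosed_compl.mem_iff_infDist_zero (nonempty_compl.2 hne)

theorem IsCozeroSet.preimage {X Y : Type*} [TopologicalSpace X] [TopologicalSpace Y] {f : X → Y}
    (hf : Continuous f) {V : Set Y} (hV : IsCozeroSet V) : IsCozeroSet (f ⁻¹' V) := by
  obtain ⟨g, hg, hVg⟩ := hV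
  exact ⟨g ∘ f, hg.comp hf, by rw [← preimage_compl, hVg, preimage_comp]⟩

theorem UFin.isProjectivelyHurewicz {X : Type u} [TopologicalSpace X]
    (h : UFin (countableCozeroCovers X) (gammaCovers X)) : IsProjectivelyHurewicz X := by
  intro Y _ _ _ f hf hsurj 𝒱 h𝒱 hsc
  let _ := TopologicalSpace.metrizableSpaceMetric Y
  have := UniformSpace.secondCountable_of_separable Y
  have hcount : ∀ n, ∃ 𝒞 : Set (Set Y), 𝒞.Countable ∧ 𝒞 ⊆ 𝒱 n ∧ ⋃₀ 𝒞 = univ := by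
    intro n
    obtain ⟨𝒞, h1, h2, h3⟩ := TopologicalSpace.isOpen_sUnion_countable (𝒱 n) (h𝒱 n).2
    exact ⟨𝒞, h1, h2, h3.trans (h𝒱 n).1.1⟩
  choose 𝒞 hC hCsub hCcov using hcount
  have hne : ∀ n, ∀ V ∈ 𝒞 n, V ≠ univ := fun n V hV hu => (h𝒱 n).1.2 (hu ▸ hCsub n hV)
  obtain ⟨ℱ, hℱ, hγ⟩ := h (fun n => Set.preimage f '' 𝒞 n)
    (fun n => by
      refine ⟨⟨?_, ?_⟩, (hC n).image _, ?_⟩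
      · rw [sUnion_preimage_image, hCcov, preimage_univ]
      · rintro ⟨V, hV, hVu⟩
        exact hne n V hV (hsurj.preimage_injective (hVu.trans preimage_univ.symm))
      · rintro _ ⟨V, hV, rfl⟩
        exact (isCozeroSet_of_isOpen ((h𝒱 n).2 V (hCsub n hV)) (hne n V hV)).preimage hf)
    (fun n => by
      rintro ⟨ℱ, hfin, hsub, hu⟩
      obtain ⟨𝒢, h𝒢, h𝒢fin, rfl⟩ := exists_subset_image_finite_and.1 ⟨ℱ, hsub, hfin, rfl⟩
      refine hsc n ⟨𝒢, ?_, h𝒢.trans (hCsub n), hsurj.preimage_injective ?_⟩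
      · exact h𝒢fin
      · rw [← sUnion_preimage_image, hu, preimage_univ])
  have hlift : ∀ n, ∃ 𝒢 : Set (Set Y), 𝒢.Finite ∧ 𝒢 ⊆ 𝒱 n ∧ Set.preimage f '' 𝒢 = ℱ n := by
    intro n
    obtain ⟨𝒢, h𝒢, he⟩ := subset_image_iff.1 (hℱ n).2
    refine ⟨𝒢, ?_, h𝒢.trans (hCsub n), he⟩
    exact Set.Finite.of_finite_image (he ▸ (hℱ n).1) hsurj.preimage_injective.injOn
  choose 𝒢 hfin hsub he using hlift
  refine ⟨𝒢, fun n => ⟨hfin n, hsub n⟩, ?_, ?_⟩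
  · rw [← isGammaCover_preimage_image_iff hsurj, ← range_comp]
    convert hγ.1 using 2
    ext1 n
    rw [Function.comp_apply, ← sUnion_preimage_image, he]
  · rintro _ ⟨n, rfl⟩
    exact isOpen_sUnion fun V hV => (h𝒱 n).2 V (hsub n hV)

/-- Countably many countable cozero covers are pulled back from the image of `X` under the
diagonal of the countably many functions that define them, a subspace of `ℝ^(ℕ × ℕ)`. -/
theorem IsProjectivelyHurewicz.uFin {X : Type u} [TopologicalSpace X]
    (h : IsProjectivelyHurewicz X) : UFin (countableCozeroCovers X) (gammaCovers X) := by
  intro 𝒰 h𝒰 hsc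
  choose f hf hfu using fun n => exists_seq_of_mem_countableCozeroCovers (h𝒰 n) (hsc n)
  let Φ : X → ℕ × ℕ → ℝ := fun x p => f p.1 p.2 x
  have hΦ : Continuous Φ := continuous_pi fun p => hf p.1 p.2
  -- The image is moved to the universe of `X`.
  let Y : Type u := ULift.{u} (range Φ)
  let φ : X → Y := fun x => ⟨rangeFactorization Φ x⟩
  have hφ : Continuous φ := continuous_uliftUp.comp hΦ.rangeFactorization
  have hsurj : Function.Surjective φ := by
    rintro ⟨_, x, rfl⟩
    exact ⟨x, rfl⟩
  have : TopologicalSpace.MetrizableSpace Y :=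
    (Homeomorph.ulift (X := range Φ)).isEmbedding.metrizableSpace
  have : SecondCountableTopology Y :=
    (Homeomorph.ulift (X := range Φ)).secondCountableTopology
  let V : ℕ → ℕ → Set Y := fun n i => {y | y.down.1 (n, i) ≠ 0}
  have hV : ∀ n i, IsOpen (V n i) := fun n i =>
    isOpen_ne_fun ((continuous_apply (n, i)).comp
      (continuous_subtype_val.comp continuous_uliftDown)) continuous_const
  have hpre : ∀ n, Set.preimage φ '' range (V n) = 𝒰 n := fun n => by
    rw [hfu n, ← range_comp]
    rfl
  obtain ⟨𝒢, h𝒢, hγ⟩ := h Y φ hφ hsurj (fun n => range (V n))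
    (fun n => by
      refine ⟨⟨hsurj.preimage_injective ?_, fun hu => (h𝒰 n).1.2 ?_⟩, ?_⟩
      · rw [← sUnion_preimage_image, hpre, (h𝒰 n).1.1, preimage_univ]
      · exact hpre n ▸ ⟨univ, hu, preimage_univ⟩
      · rintro _ ⟨i, rfl⟩
        exact hV n i)
    (fun n => by
      rintro ⟨ℱ, hfin, hsub, hu⟩
      refine hsc n ⟨Set.preimage φ '' ℱ, hfin.image _, hpre n ▸ image_mono hsub, ?_⟩
      rw [sUnion_preimage_image, hu, preimage_univ])
  refine ⟨fun n => Set.preimage φ '' 𝒢 n,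
    fun n => ⟨(h𝒢 n).1.image _, hpre n ▸ image_mono (h𝒢 n).2⟩, ?_, ?_⟩
  · have := (isGammaCover_preimage_image_iff hsurj).2 hγ.1
    rw [← range_comp] at this
    simp only [sUnion_preimage_image]
    exact this
  · rintro _ ⟨n, rfl⟩
    refine isOpen_sUnion ?_
    rintro _ ⟨W, hW, rfl⟩
    obtain ⟨i, rfl⟩ := (h𝒢 n).2 hW
    exact (hV n i).preimage hφ

end SelPrinciples

theorem mainTheorem1 (X : Type u) [TopologicalSpace X] [T35Space X] :
    List.TFAE
      [SelPrinciples.SFin (SelPrinciples.gammaAt (SelPrinciples.Cp.zero X))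
          (SelPrinciples.weakGammaAt (SelPrinciples.Cp.zero X)),
        SelPrinciples.SFin (SelPrinciples.gammaFCovers X) (SelPrinciples.omegaGroupableCovers X),
        SelPrinciples.UFin (SelPrinciples.gammaFCovers X) (SelPrinciples.gammaCovers X),
        SelPrinciples.UFin (SelPrinciples.countableCozeroCovers X) (SelPrinciples.gammaCovers X),
        SelPrinciples.IsProjectivelyHurewicz X] := by
  tfae_have 4 → 1 := SelPrinciples.UFin.sFin_weakGammaAt
  tfae_have 4 → 2 := SelPrinciples.UFin.sFin_omegaGroupable
  tfae_have 1 → 3 := SelPrinciples.SFin.uFin_of_weakGammaAt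
  tfae_have 2 → 3 := SelPrinciples.SFin.uFin_of_omegaGroupable
  tfae_have 3 → 4 := SelPrinciples.UFin.uFin_countableCozeroCovers
  tfae_have 4 → 5 := SelPrinciples.UFin.isProjectivelyHurewicz
  tfae_have 5 → 4 := SelPrinciples.IsProjectivelyHurewicz.uFin
  tfae_finish
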